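/- Let $n,t\ge 1$ be integers, let $\mathbb R[X]=\mathbb R[X_1,\dots,X_n]$, and let $M_t(\mathbb R[X])$ be the algebra of $t\times t$ matrices with entries in $\mathbb R[X]$. A matrix-valued measure on $\mathbb R^n$ is a family $\mathbf E=(\sigma_{ij})_{i,j=1}^t$ of finite signed Borel measures on $\mathbb R^n$, with $\mathbf E(A)=(\sigma_{ij}(A))_{i,j}$ for Borel sets $A$; its support is $\operatorname{supp}\mathbf E=\bigcup_{i,j}\operatorname{supp}\sigma_{ij}$, where $\operatorname{supp}\sigma_{ij}$ is the support of the total variation measure of $\sigma_{ij}$. It is called positive semidefinite if $\sigma_{ij}=\sigma_{ji}$ for all $i,j$ and $v^T\mathbf E(A)v\ge 0$ for every Borel set $A$ and every $v\in\mathbb R^t$. For a closed set $K\subseteq\mathbb R^n$, a linear functional $\mathcal L:M_t(\mathbb R[X])\to\mathbb R$ is called a tracial $K$-moment functional if there is a positive semidefinite matrix-valued measure $\mathbf E=(\sigma_{ij})$ on $\mathbb R^n$ with $\operatorname{supp}\mathbf E\subseteq K$ such that, for every $\mathbf F=(F_{ij})\in M_t(\mathbb R[X])$, each $F_{ij}$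 is integrable with respect to $\sigma_{ji}$ and $$\mathcal L(\mathbf F)=\int \operatorname{tr}\big(\mathbf F(x)\,d\mathbf E(x)\big)=\sum_{i,j=1}^t\int F_{ij}(x)\,d\sigma_{ji}(x).$$ A matrix $\mathbf G\in M_t(\mathbb R)$, not assumed to be symmetric, is called positive definite if $v^T\mathbf G v>0$ for all $v\in\mathbb R^t\setminus\{0\}$. Put $l_{2i-1}=1+X_i$ and $l_{2i}=1-X_i$ for $i=1,\dots,n$. Let $\mathcal L$ be a real-valued linear functional on $M_t(\mathbb R[X])$. Then the following are equivalent. 1. $\mathcal L$ is a tracial $[-1,1]^n$-moment functional. 2. $\mathcal L\big(l_1^{\alpha_1}l_2^{\alpha_2}\cdots l_{2n-1}^{\alpha_{2n-1}}l_{2n}^{\alpha_{2n}}\,\mathbf G\big)\ge 0$ for all positive definite matrices $\mathbf G\in M_t(\mathbb R)$ and all $\alpha=(\alpha_1,\dots,\alpha_{2n})\in\mathbb N_0^{2n}$. -/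

import Mathlib

open MeasureTheory

namespace TracialMoment

/-- A `t × t` matrix-valued measure on `ℝⁿ`: a `t × t` family of finite signed Borel measures. -/
abbrev MatrixMeasure (n t : ℕ) : Type :=
  Matrix (Fin t) (Fin t) (SignedMeasure (Fin n → ℝ))

namespace MatrixMeasure

variable {n t : ℕ}

/-- The value `E(A) = (σ_ij(A))` of a matrix-valued measure on a set `A`. -/
noncomputable def value (E : MatrixMeasure n t) (A : Set (Fin n → ℝ)) :
    Matrix (Fin t) (Fin t) ℝ :=
  Matrix.of fun i j => E i j A

/-- A positive semidefinite matrix-valued measure: it is symmetric, and `vᵀ E(A) v ≥ 0` for every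
Borel set `A` and every vector `v`. -/
def IsPosSemidef (E : MatrixMeasure n t) : Prop :=
  (∀ i j, E i j = E j i) ∧
    ∀ A : Set (Fin n → ℝ), MeasurableSet A → ∀ v : Fin t → ℝ,
      0 ≤ dotProduct v ((E.value A).mulVec v)

/-- The support of a matrix-valued measure: the union of the supports of its entries, where the
support of a signed measure is the support of its total variation measure. -/
def supp (E : MatrixMeasure n t) : Set (Fin n → ℝ) :=
  ⋃ i, ⋃ j, (E i j).variation.support

/-- Integrability of a matrix polynomial `F` against `E`: each function `F_ij` is integrable
against the signed measure `E_ji`. -/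
def PolyIntegrable (E : MatrixMeasure n t)
    (F : Matrix (Fin t) (Fin t) (MvPolynomial (Fin n) ℝ)) : Prop :=
  ∀ i j, (E j i).Integrable fun x => MvPolynomial.eval x (F i j)

/-- The integral `∫ tr(F(x) dE(x)) = ∑ᵢ ∑ⱼ ∫ F_ij(x) dE_ji(x)`. -/
noncomputable def traceIntegral (E : MatrixMeasure n t)
    (F : Matrix (Fin t) (Fin t) (MvPolynomial (Fin n) ℝ)) : ℝ :=
  ∑ i, ∑ j, ∫ᵛ x, MvPolynomial.eval x (F i j) ∂<•(E j i)

end MatrixMeasure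

/-- `L` is a tracial `K`-moment functional: it is represented by a positive semidefinite
matrix-valued measure supported in `K`. -/
def IsTracialMomentFunctional {n t : ℕ} (K : Set (Fin n → ℝ))
    (L : Matrix (Fin t) (Fin t) (MvPolynomial (Fin n) ℝ) →ₗ[ℝ] ℝ) : Prop :=
  ∃ E : MatrixMeasure n t, E.IsPosSemidef ∧ E.supp ⊆ K ∧
    ∀ F, E.PolyIntegrable F ∧ L F = E.traceIntegral F

/-- A real square matrix `G` is positive definite if `vᵀ G v > 0` for every nonzero vector `v`.
The matrix is not required to be symmetric (so this is weaker than `Matrix.PosDef`). -/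
def IsPositiveDefinite {t : ℕ} (G : Matrix (Fin t) (Fin t) ℝ) : Prop :=
  ∀ v : Fin t → ℝ, v ≠ 0 → 0 < dotProduct v (G.mulVec v)

/-- The hypercube `[-1,1]ⁿ`. -/
def hypercube (n : ℕ) : Set (Fin n → ℝ) :=
  {x | ∀ i, x i ∈ Set.Icc (-1 : ℝ) 1}

/-- The linear polynomials `1 + X₁, 1 - X₁, …, 1 + Xₙ, 1 - Xₙ`, listed in this order with indices
`0, 1, …, 2n - 1`. -/
noncomputable def boxPoly (n : ℕ) (j : Fin (2 * n)) : MvPolynomial (Fin n) ℝ :=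
  if (j : ℕ) % 2 = 0 then 1 + MvPolynomial.X ⟨(j : ℕ) / 2, by omega⟩
  else 1 - MvPolynomial.X ⟨(j : ℕ) / 2, by omega⟩

/-- A scalar matrix regarded as a constant matrix polynomial. -/
noncomputable def constMatrix (n : ℕ) {t : ℕ} (G : Matrix (Fin t) (Fin t) ℝ) :
    Matrix (Fin t) (Fin t) (MvPolynomial (Fin n) ℝ) :=
  G.map MvPolynomial.C

end TracialMoment

/-!
A tracial functional `L` is controlled by the scalar functionals `p ↦ L (p G)`, one for each
constant matrix `G`.

For fixed `G`, nonnegativity of such a functional on the products of the constraint polynomials is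
nonnegativity on the semiring they generate. Because that semiring is archimedean, its states form
a compact convex set, and an extreme state is multiplicative: it is a convex combination of its own
localizations at `g` and `r - g`, hence equal to both. So the extreme states are evaluations at
points of the semialgebraic set `K`, and by Krein–Milman the functional is nonnegative on every
polynomial that is nonnegative on `K`. By Haviland's theorem it is integration against a measure on
`K`, which is unique since polynomials are dense in `C(K)`.

Every matrix unit is a difference of two matrices with nonnegative quadratic form, so the matrix
units give signed measures `σ i j`. By uniqueness, `∑ i j, G i j • σ j i` is the measure belonging
to `G` whenever `G` has nonnegative quadratic form. Its nonnegativity for `G = v vᵀ` is positive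
semidefiniteness of `σ`, and for the skew-symmetric `G = e_ij - e_ji`, which is allowed because `G`
need not be symmetric, it yields the symmetry `σ i j = σ j i`.
-/

namespace TracialMoment

open MvPolynomial Filter Topology
open scoped NNReal Matrix

section Archimedean

variable {A : Type*} [CommRing A] [Algebra ℝ A] {P : Subalgebra ℝ≥0 A}

/-- A subsemiring of an `ℝ`-algebra that is closed under multiplication by nonnegative reals
(encoded as an `ℝ≥0`-subalgebra) is *archimedean* if every element of the algebra is dominated by
a real constant in the preorder `a ≤ b ↔ b - a ∈ P`. -/
def IsArchimedean (P : Subalgebra ℝ≥0 A) : Prop :=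
  ∀ a, ∃ r : ℝ, algebraMap ℝ A r - a ∈ P

lemma algebraMap_mem_of_nonneg (P : Subalgebra ℝ≥0 A) {r : ℝ} (hr : 0 ≤ r) :
    algebraMap ℝ A r ∈ P := by
  lift r to ℝ≥0 using hr
  exact P.algebraMap_mem r

lemma IsArchimedean.exists_gt (hP : IsArchimedean P) (a : A) (c : ℝ) :
    ∃ r > c, algebraMap ℝ A r - a ∈ P := by
  obtain ⟨r, hr⟩ := hP a
  refine ⟨max r c + 1, by linarith [le_max_right r c], ?_⟩
  have hle : 0 ≤ max r c + 1 - r := by linarith [le_max_left r c]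
  convert P.add_mem hr (algebraMap_mem_of_nonneg P hle) using 1
  rw [map_sub]; ring

/-- The elements lying between two real constants `-r` and `r` in the preorder defined by `P`. -/
def boundedElements (P : Subalgebra ℝ≥0 A) : Subalgebra ℝ A where
  carrier := {a | ∃ r : ℝ, algebraMap ℝ A r - a ∈ P ∧ algebraMap ℝ A r + a ∈ P}
  algebraMap_mem' r := by
    refine ⟨|r|, ?_, ?_⟩
    · rw [← map_sub]
      exact algebraMap_mem_of_nonneg P (by linarith [le_abs_self r])
    · rw [← map_add]
      exact algebraMap_mem_of_nonneg P (by linarith [neg_abs_le r])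
  add_mem' := by
    rintro a b ⟨r, hra, hra'⟩ ⟨s, hsb, hsb'⟩
    refine ⟨r + s, ?_, ?_⟩
    · convert P.add_mem hra hsb using 1
      rw [map_add]; ring
    · convert P.add_mem hra' hsb' using 1
      rw [map_add]; ring
  mul_mem' := by
    rintro a b ⟨r, hra, hra'⟩ ⟨s, hsb, hsb'⟩
    have half : algebraMap ℝ A (1 / 2) * 2 = 1 := by
      rw [← map_ofNat (algebraMap ℝ A) 2, ← map_mul]; norm_num
    have half_mem : algebraMap ℝ A (1 / 2) ∈ P := algebraMap_mem_of_nonneg P (by norm_num)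
    refine ⟨r * s, ?_, ?_⟩
    · convert P.mul_mem half_mem (P.add_mem (P.mul_mem hra hsb') (P.mul_mem hra' hsb)) using 1
      rw [map_mul]
      linear_combination (a * b - algebraMap ℝ A r * algebraMap ℝ A s) * half
    · convert P.mul_mem half_mem (P.add_mem (P.mul_mem hra hsb) (P.mul_mem hra' hsb')) using 1
      rw [map_mul]
      linear_combination -(a * b + algebraMap ℝ A r * algebraMap ℝ A s) * half

lemma isArchimedean_of_boundedElements_eq_top (h : boundedElements P = ⊤) : IsArchimedean P := by
  intro a
  obtain ⟨r, hr, -⟩ : a ∈ boundedElements P := h ▸ Algebra.mem_top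
  exact ⟨r, hr⟩

/-- The set of states of `(A, P)`: the normalised linear functionals that are nonnegative on `P`.
They are regarded as elements of the locally convex space `A → ℝ` of all functions, whose product
topology induces the weak-* topology. -/
def states (P : Subalgebra ℝ≥0 A) : Set (A → ℝ) :=
  {f | ∃ Λ : A →ₗ[ℝ] ℝ, ⇑Λ = f ∧ Λ 1 = 1 ∧ ∀ a ∈ P, 0 ≤ Λ a}

lemma coe_mem_states {Λ : A →ₗ[ℝ] ℝ} :
    ⇑Λ ∈ states P ↔ Λ 1 = 1 ∧ ∀ a ∈ P, 0 ≤ Λ a := by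
  constructor
  · rintro ⟨Λ', hΛ', h⟩
    rwa [← DFunLike.coe_injective hΛ']
  · exact fun h => ⟨Λ, rfl, h⟩

lemma convex_states (P : Subalgebra ℝ≥0 A) : Convex ℝ (states P) := by
  rintro _ ⟨Λ, rfl, hΛ1, hΛ⟩ _ ⟨Λ', rfl, hΛ'1, hΛ'⟩ r s hr hs hrs
  refine ⟨r • Λ + s • Λ', rfl, by simp [hΛ1, hΛ'1, hrs], fun a ha => ?_⟩
  exact add_nonneg (mul_nonneg hr (hΛ a ha)) (mul_nonneg hs (hΛ' a ha))

lemma isClosed_states (P : Subalgebra ℝ≥0 A) : IsClosed (states P) := by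
  have : states P = Set.range ((↑) : (A →ₗ[ℝ] ℝ) → A → ℝ) ∩
      ({f | f 1 = 1} ∩ ⋂ a ∈ P, {f | 0 ≤ f a}) := by
    ext f
    simp only [states, Set.mem_inter_iff, Set.mem_range, Set.mem_iInter, Set.mem_ofPred_eq]
    constructor
    · rintro ⟨Λ, rfl, h⟩
      exact ⟨⟨Λ, rfl⟩, h⟩
    · rintro ⟨⟨Λ, rfl⟩, h⟩
      exact ⟨Λ, rfl, h⟩
  rw [this]
  refine (LinearMap.isClosed_range_coe A ℝ _).inter
    ((isClosed_eq (continuous_apply 1) continuous_const).inter ?_)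
  exact isClosed_biInter fun a _ => isClosed_le continuous_const (continuous_apply a)

lemma le_of_algebraMap_sub_mem {Λ : A →ₗ[ℝ] ℝ} (hΛ : ∀ a ∈ P, 0 ≤ Λ a) {a : A} {r : ℝ}
    (h : algebraMap ℝ A r - a ∈ P) : Λ a ≤ r * Λ 1 := by
  have := hΛ _ h
  rwa [map_sub, Algebra.algebraMap_eq_smul_one, map_smul, sub_nonneg, smul_eq_mul] at this

lemma IsArchimedean.isCompact_states (hP : IsArchimedean P) : IsCompact (states P) := by
  choose r hr using hP
  refine (isCompact_univ_pi fun a => isCompact_Icc (a := -r (-a)) (b := r a)).of_isClosed_subset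
    (isClosed_states P) ?_
  rintro _ ⟨Λ, rfl, hΛ1, hΛ⟩ a -
  have hneg := le_of_algebraMap_sub_mem hΛ (hr (-a))
  have hpos := le_of_algebraMap_sub_mem hΛ (hr a)
  rw [hΛ1, mul_one] at hneg hpos
  rw [map_neg] at hneg
  exact ⟨by linarith, hpos⟩

lemma localization_mem_states {Λ : A →ₗ[ℝ] ℝ} (hΛ : ∀ a ∈ P, 0 ≤ Λ a) {g : A} (hg : g ∈ P)
    (hΛg : 0 < Λ g) : ⇑((Λ g)⁻¹ • Λ ∘ₗ LinearMap.mulLeft ℝ g) ∈ states P := by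
  refine coe_mem_states.2 ⟨by simp [hΛg.ne'], fun a ha => ?_⟩
  exact mul_nonneg (inv_nonneg.2 hΛg.le) (hΛ _ (P.mul_mem hg ha))

lemma map_algebraMap_of_map_one {Λ : A →ₗ[ℝ] ℝ} (hΛ : Λ 1 = 1) (r : ℝ) :
    Λ (algebraMap ℝ A r) = r := by
  rw [Algebra.algebraMap_eq_smul_one, map_smul, hΛ, smul_eq_mul, mul_one]

lemma map_mul_of_mem_extremePoints_of_pos {Λ : A →ₗ[ℝ] ℝ}
    (hΛ : ⇑Λ ∈ Set.extremePoints ℝ (states P)) {g : A} {r : ℝ} (hg : g ∈ P)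
    (hrg : algebraMap ℝ A r - g ∈ P) (hΛg : 0 < Λ g) (hΛgr : Λ g < r) (a : A) :
    Λ (g * a) = Λ g * Λ a := by
  obtain ⟨hmem, hext⟩ := mem_extremePoints_iff_left.1 hΛ
  obtain ⟨hΛ1, hΛP⟩ := coe_mem_states.1 hmem
  set h := algebraMap ℝ A r - g with hh
  have hΛh : Λ h = r - Λ g := by rw [hh, map_sub, map_algebraMap_of_map_one hΛ1]
  have hΛh0 : 0 < Λ h := by linarith
  have hr0 : 0 < r := hΛg.trans hΛgr
  -- `Λ` is a convex combination of its localizations at `g` and `r - g`.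
  have hseg : ⇑Λ ∈ openSegment ℝ ⇑((Λ g)⁻¹ • Λ ∘ₗ LinearMap.mulLeft ℝ g)
      ⇑((Λ h)⁻¹ • Λ ∘ₗ LinearMap.mulLeft ℝ h) := by
    refine ⟨Λ g / r, Λ h / r, by positivity, by positivity, ?_, funext fun a => ?_⟩
    · rw [hΛh]; field_simp; ring
    · have hha : Λ (h * a) = r * Λ a - Λ (g * a) := by
        rw [hh, sub_mul, map_sub, ← Algebra.smul_def, map_smul, smul_eq_mul]
      simp only [Pi.add_apply, Pi.smul_apply, LinearMap.smul_apply, LinearMap.comp_apply,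
        LinearMap.mulLeft_apply, smul_eq_mul, hha]
      field_simp
      ring
  have heq : (Λ g)⁻¹ * Λ (g * a) = Λ a := congrFun (hext _ (localization_mem_states hΛP hg hΛg) _
    (localization_mem_states hΛP hrg hΛh0) hseg) a
  rwa [inv_mul_eq_iff_eq_mul₀ hΛg.ne'] at heq

lemma map_mul_of_mem_extremePoints (hP : IsArchimedean P) {Λ : A →ₗ[ℝ] ℝ}
    (hΛ : ⇑Λ ∈ Set.extremePoints ℝ (states P)) (a b : A) : Λ (a * b) = Λ a * Λ b := by
  have hΛ1 : Λ 1 = 1 := (coe_mem_states.1 (extremePoints_subset hΛ)).1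
  obtain ⟨r, hr, hra⟩ := hP.exists_gt (-a) (Λ (-a))
  rw [sub_neg_eq_add] at hra
  obtain ⟨s, hs, hsa⟩ := hP.exists_gt (algebraMap ℝ A r + a) (Λ (algebraMap ℝ A r + a))
  have hpos : 0 < Λ (algebraMap ℝ A r + a) := by
    rw [map_neg] at hr
    rw [map_add, map_algebraMap_of_map_one hΛ1]
    linarith
  have hmul := map_mul_of_mem_extremePoints_of_pos hΛ hra hsa hpos hs b
  rw [add_mul, map_add, map_add, map_algebraMap_of_map_one hΛ1, ← Algebra.smul_def, map_smul,
    smul_eq_mul] at hmul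
  linarith

/-- **Kadison–Dubois representation theorem**, in dual form. -/
theorem IsArchimedean.nonneg_of_forall_algHom_nonneg (hP : IsArchimedean P) {Λ : A →ₗ[ℝ] ℝ}
    (hΛ : ∀ a ∈ P, 0 ≤ Λ a) {a : A}
    (ha : ∀ χ : A →ₐ[ℝ] ℝ, (∀ b ∈ P, 0 ≤ χ b) → 0 ≤ χ a) : 0 ≤ Λ a := by
  have hstates : states P ⊆ {f | 0 ≤ f a} := by
    rw [← closure_convexHull_extremePoints hP.isCompact_states (convex_states P)]
    refine closure_minimal (convexHull_min ?_ ?_)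
      (isClosed_le continuous_const (continuous_apply a))
    · intro f hf
      obtain ⟨χ, rfl, hχ1, hχ⟩ := extremePoints_subset hf
      exact ha (AlgHom.ofLinearMap χ hχ1 (map_mul_of_mem_extremePoints hP hf)) hχ
    · exact convex_halfSpace_ge (LinearMap.proj (R := ℝ) (φ := fun _ : A => ℝ) a).isLinear 0
  rcases (hΛ 1 P.one_mem).eq_or_lt with h0 | hpos
  · obtain ⟨r, hr⟩ := hP (-a)
    have := le_of_algebraMap_sub_mem hΛ hr
    rw [← h0, map_neg] at this
    linarith
  · have : 0 ≤ (Λ 1)⁻¹ * Λ (1 * a) := hstates (localization_mem_states hΛ P.one_mem hpos)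
    rw [one_mul] at this
    exact (mul_nonneg_iff_of_pos_left (inv_pos.2 hpos)).1 this

end Archimedean

section Semialgebraic

variable {ι κ : Type*}

lemma map_nonneg_of_mem_adjoin_range [Fintype κ] {A : Type*} [CommRing A] [Algebra ℝ A]
    {g : κ → A} {Λ : A →ₗ[ℝ] ℝ} (hΛ : ∀ α : κ → ℕ, 0 ≤ Λ (∏ j, g j ^ α j)) {a : A}
    (ha : a ∈ Algebra.adjoin ℝ≥0 (Set.range g)) : 0 ≤ Λ a := by
  rw [← Subalgebra.mem_toSubmodule, Algebra.adjoin_eq_span] at ha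
  induction ha using Submodule.span_induction with
  | mem b hb =>
    obtain ⟨α, rfl⟩ := Submonoid.mem_closure_range_iff_of_fintype.1 hb
    exact hΛ α
  | zero => rw [map_zero]
  | add b c _ _ hb hc => rw [map_add]; exact add_nonneg hb hc
  | smul r b _ hb => rw [NNReal.smul_def, map_smul]; exact mul_nonneg r.2 hb

/-- The basic closed semialgebraic set of points where all the polynomials `g j` are
nonnegative. -/
def nonnegSet (g : κ → MvPolynomial ι ℝ) : Set (ι → ℝ) :=
  {x | ∀ j, 0 ≤ eval x (g j)}

lemma eval_nonneg_of_mem_adjoin_range {g : κ → MvPolynomial ι ℝ} {x : ι → ℝ}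
    (hx : x ∈ nonnegSet g) {p : MvPolynomial ι ℝ}
    (hp : p ∈ Algebra.adjoin ℝ≥0 (Set.range g)) : 0 ≤ eval x p := by
  induction hp using Algebra.adjoin_induction with
  | mem p hp => obtain ⟨j, rfl⟩ := hp; exact hx j
  | algebraMap r => rw [MvPolynomial.algebraMap_apply, eval_C]; exact r.2
  | add p q _ _ hp hq => rw [map_add]; exact add_nonneg hp hq
  | mul p q _ _ hp hq => rw [map_mul]; exact mul_nonneg hp hq

/-- **Krivine's Positivstellensatz**, in dual form. -/
theorem nonneg_of_nonneg_on_nonnegSet [Fintype κ] {g : κ → MvPolynomial ι ℝ}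
    (hg : IsArchimedean (Algebra.adjoin ℝ≥0 (Set.range g))) {Λ : MvPolynomial ι ℝ →ₗ[ℝ] ℝ}
    (hΛ : ∀ α : κ → ℕ, 0 ≤ Λ (∏ j, g j ^ α j)) {p : MvPolynomial ι ℝ}
    (hp : ∀ x ∈ nonnegSet g, 0 ≤ eval x p) : 0 ≤ Λ p := by
  refine hg.nonneg_of_forall_algHom_nonneg (fun q => map_nonneg_of_mem_adjoin_range hΛ)
    fun χ hχ => ?_
  have heval : ∀ q, χ q = eval (fun i => χ (X i)) q := fun q => by
    rw [← aeval_eq_eval]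
    exact DFunLike.congr_fun (aeval_unique χ) q
  rw [heval]
  refine hp _ fun j => ?_
  rw [← heval]
  exact hχ _ (Algebra.subset_adjoin ⟨j, rfl⟩)

lemma isClosed_nonnegSet (g : κ → MvPolynomial ι ℝ) : IsClosed (nonnegSet g) := by
  simp only [nonnegSet, Set.ofPred_forall]
  exact isClosed_iInter fun j => isClosed_le continuous_const (continuous_eval (g j))

lemma isCompact_nonnegSet {g : κ → MvPolynomial ι ℝ}
    (hg : IsArchimedean (Algebra.adjoin ℝ≥0 (Set.range g))) : IsCompact (nonnegSet g) := by
  choose r hr using hg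
  have hbox : IsCompact (Set.univ.pi fun i => Set.Icc (-r (-X i)) (r (X i))) :=
    isCompact_univ_pi fun i => isCompact_Icc
  refine hbox.of_isClosed_subset (isClosed_nonnegSet g) fun x hx i _ => ?_
  have hneg := eval_nonneg_of_mem_adjoin_range hx (hr (-X i))
  have hpos := eval_nonneg_of_mem_adjoin_range hx (hr (X i))
  simp only [MvPolynomial.algebraMap_eq, map_sub, map_neg, eval_C, eval_X] at hneg hpos
  exact ⟨by linarith, by linarith⟩

end Semialgebraic

section Haviland

section DenseRange

variable {X V : Type*} [TopologicalSpace X] [CompactSpace X] [AddCommGroup V] [Module ℝ V]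
  {φ : V →ₗ[ℝ] C(X, ℝ)}

lemma norm_le_mul_norm_of_nonneg {e : V} (he : φ e = 1) {Λ : V →ₗ[ℝ] ℝ}
    (hΛ : ∀ v, 0 ≤ φ v → 0 ≤ Λ v) (v : V) : ‖Λ v‖ ≤ Λ e * ‖φ v‖ := by
  have hle : ∀ w, Λ w ≤ Λ e * ‖φ w‖ := fun w => by
    have := hΛ (‖φ w‖ • e - w) fun x => by
      simpa [he] using (le_abs_self _).trans ((φ w).norm_coe_le_norm x)
    rw [map_sub, map_smul, smul_eq_mul] at this
    linarith
  have hneg := hle (-v)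
  rw [map_neg, map_neg, norm_neg] at hneg
  exact abs_le.2 ⟨by linarith, hle v⟩

lemma nonneg_of_norm_le_map_one {Λ : C(X, ℝ) →L[ℝ] ℝ} (hΛ : ‖Λ‖ ≤ Λ 1) {f : C(X, ℝ)}
    (hf : 0 ≤ f) : 0 ≤ Λ f := by
  have hnorm : ‖‖f‖ • 1 - f‖ ≤ ‖f‖ := by
    refine (ContinuousMap.norm_le _ (norm_nonneg f)).2 fun x => ?_
    have hx : 0 ≤ f x := hf x
    have hxf : f x ≤ ‖f‖ := (le_abs_self _).trans (f.norm_coe_le_norm x)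
    rw [ContinuousMap.sub_apply, ContinuousMap.smul_apply, ContinuousMap.one_apply, smul_eq_mul,
      mul_one, Real.norm_of_nonneg (sub_nonneg.2 hxf)]
    linarith
  have : ‖f‖ * Λ 1 - Λ f ≤ Λ 1 * ‖f‖ :=
    calc ‖f‖ * Λ 1 - Λ f = Λ (‖f‖ • 1 - f) := by rw [map_sub, map_smul, smul_eq_mul]
      _ ≤ ‖Λ (‖f‖ • 1 - f)‖ := le_abs_self _
      _ ≤ Λ 1 * ‖f‖ := (Λ.le_of_opNorm_le hΛ _).trans
        (mul_le_mul_of_nonneg_left hnorm ((norm_nonneg Λ).trans hΛ))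
  linarith

variable [MeasurableSpace X] [BorelSpace X]

lemma exists_measure_of_nonneg_continuousMap [T2Space X] (Λ : C(X, ℝ) →ₗ[ℝ] ℝ)
    (hΛ : ∀ f, 0 ≤ f → 0 ≤ Λ f) :
    ∃ μ : Measure X, IsFiniteMeasure μ ∧ ∀ f : C(X, ℝ), ∫ x, f x ∂μ = Λ f := by
  let Λc : CompactlySupportedContinuousMap X ℝ →ₚ[ℝ] ℝ :=
    { toFun f := Λ f.toContinuousMap
      map_add' f g := map_add Λ _ _
      map_smul' r f := map_smul Λ r _
      monotone' f g hfg := by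
        rw [← sub_nonneg, ← map_sub]
        exact hΛ _ fun x => sub_nonneg.2 (hfg x) }
  exact ⟨RealRMK.rieszMeasure Λc, inferInstance, fun f =>
    RealRMK.integral_rieszMeasure Λc ⟨f, HasCompactSupport.of_compactSpace _⟩⟩

lemma exists_measure_of_nonneg_of_denseRange [T2Space X] (hφ : DenseRange φ) {e : V}
    (he : φ e = 1) {Λ : V →ₗ[ℝ] ℝ} (hΛ : ∀ v, 0 ≤ φ v → 0 ≤ Λ v) :
    ∃ μ : Measure X, IsFiniteMeasure μ ∧ ∀ v, ∫ x, φ v x ∂μ = Λ v := by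
  have hbound := norm_le_mul_norm_of_nonneg he hΛ
  have hext : ∀ v, Λ.extendOfNorm φ (φ v) = Λ v := LinearMap.extendOfNorm_eq hφ ⟨_, hbound⟩
  have hnorm : ‖Λ.extendOfNorm φ‖ ≤ Λ.extendOfNorm φ 1 := by
    rw [← he, hext]
    exact ContinuousLinearMap.opNorm_le_bound _ (hΛ e (he ▸ zero_le_one))
      (LinearMap.norm_extendOfNorm_apply_le hφ _ hbound)
  obtain ⟨μ, hμ, hμΛ⟩ := exists_measure_of_nonneg_continuousMap (Λ.extendOfNorm φ).toLinearMap
    fun f hf => nonneg_of_norm_le_map_one hnorm hf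
  exact ⟨μ, hμ, fun v => (hμΛ _).trans (hext v)⟩

lemma measure_ext_of_denseRange [HasOuterApproxClosed X] (hφ : DenseRange φ) {μ ν : Measure X}
    [IsFiniteMeasure μ] [IsFiniteMeasure ν] (h : ∀ v, ∫ x, φ v x ∂μ = ∫ x, φ v x ∂ν) : μ = ν := by
  have hcont : ∀ (ρ : Measure X) [IsFiniteMeasure ρ],
      Continuous fun f : C(X, ℝ) => ∫ x, f x ∂ρ := fun ρ _ =>
    (continuous_integral.comp (ContinuousMap.toLp (E := ℝ) 1 ρ ℝ).continuous).congr fun f =>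
      integral_congr_ae (ContinuousMap.coeFn_toLp ρ f)
  have heq := hφ.equalizer (hcont μ) (hcont ν) (funext h)
  exact ext_of_forall_integral_eq_of_IsFiniteMeasure fun f => congrFun heq f.toContinuousMap

end DenseRange

variable {ι : Type*} {K : Set (ι → ℝ)}

/-- The algebra homomorphism sending a polynomial to the continuous function it defines on `K`. -/
noncomputable def polyToContinuousMap (K : Set (ι → ℝ)) : MvPolynomial ι ℝ →ₐ[ℝ] C(K, ℝ) :=
  aeval fun i => ⟨fun x => (x : ι → ℝ) i, (continuous_apply i).comp continuous_subtype_val⟩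

lemma polyToContinuousMap_apply (p : MvPolynomial ι ℝ) (x : K) :
    polyToContinuousMap K p x = eval (x : ι → ℝ) p := by
  rw [polyToContinuousMap, ← ContinuousMap.evalAlgHom_apply ℝ ℝ, MvPolynomial.comp_aeval_apply,
    ← coe_aeval_eq_eval]
  rfl

lemma denseRange_polyToContinuousMap (hK : IsCompact K) : DenseRange (polyToContinuousMap K) := by
  have : CompactSpace K := isCompact_iff_compactSpace.1 hK
  have htop := ContinuousMap.subalgebra_topologicalClosure_eq_top_of_separatesPoints
    (polyToContinuousMap K).range fun x y hxy => by
      obtain ⟨i, hi⟩ := Function.ne_iff.1 (Subtype.coe_injective.ne hxy)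
      exact ⟨_, ⟨_, ⟨X i, rfl⟩, rfl⟩, by simpa [polyToContinuousMap_apply] using hi⟩
  intro f
  have : f ∈ (polyToContinuousMap K).range.topologicalClosure := htop ▸ Algebra.mem_top
  simpa using! this

variable [Countable ι]

/-- **Haviland's theorem** for compact sets. -/
theorem exists_measure_of_nonneg (hK : IsCompact K) {Λ : MvPolynomial ι ℝ →ₗ[ℝ] ℝ}
    (hΛ : ∀ p, (∀ x ∈ K, 0 ≤ eval x p) → 0 ≤ Λ p) :
    ∃ μ : Measure (ι → ℝ), IsFiniteMeasure μ ∧ μ Kᶜ = 0 ∧ ∀ p, ∫ x, eval x p ∂μ = Λ p := by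
  have : CompactSpace K := isCompact_iff_compactSpace.1 hK
  obtain ⟨μ, hμ, hμΛ⟩ := exists_measure_of_nonneg_of_denseRange
    (φ := (polyToContinuousMap K).toLinearMap) (denseRange_polyToContinuousMap hK)
    (map_one (polyToContinuousMap K)) fun p hp => hΛ p fun x hx => by
      rw [← polyToContinuousMap_apply p ⟨x, hx⟩]
      exact hp ⟨x, hx⟩
  refine ⟨μ.map Subtype.val, inferInstance, ?_, fun p => ?_⟩
  · rw [Measure.map_apply measurable_subtype_coe hK.measurableSet.compl]
    simp
  · rw [integral_map measurable_subtype_coe.aemeasurable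
      (continuous_eval p).aestronglyMeasurable, ← hμΛ p]
    simp only [AlgHom.toLinearMap_apply, polyToContinuousMap_apply]

theorem measure_eq_of_integral_eval_eq (hK : IsCompact K) {μ ν : Measure (ι → ℝ)}
    [IsFiniteMeasure μ] [IsFiniteMeasure ν] (hμ : μ Kᶜ = 0) (hν : ν Kᶜ = 0)
    (h : ∀ p : MvPolynomial ι ℝ, ∫ x, eval x p ∂μ = ∫ x, eval x p ∂ν) : μ = ν := by
  have : CompactSpace K := isCompact_iff_compactSpace.1 hK
  have hrestrict : ∀ {ρ : Measure (ι → ℝ)}, ρ Kᶜ = 0 → ρ.restrict K = ρ := fun hρ =>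
    Measure.restrict_eq_self_of_ae_mem hρ
  have hcomap : μ.comap ((↑) : K → ι → ℝ) = ν.comap (↑) :=
    measure_ext_of_denseRange (φ := (polyToContinuousMap K).toLinearMap)
      (denseRange_polyToContinuousMap hK) fun p => by
      simp only [AlgHom.toLinearMap_apply, polyToContinuousMap_apply]
      rw [integral_subtype_comap hK.measurableSet (fun x => eval x p),
        integral_subtype_comap hK.measurableSet (fun x => eval x p), hrestrict hμ, hrestrict hν, h]
  rw [← hrestrict hμ, ← hrestrict hν, ← map_comap_subtype_coe hK.measurableSet,
    ← map_comap_subtype_coe hK.measurableSet, hcomap]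

end Haviland

section RepresentingMeasure

variable {ι : Type*} {K : Set (ι → ℝ)} {σ τ : SignedMeasure (ι → ℝ)}
  {Λ Λ' : MvPolynomial ι ℝ →ₗ[ℝ] ℝ}

/-- The signed measure `σ` is carried by `K` and represents the functional `Λ` on polynomials:
`Λ p = ∫ p dσ`, where integrability is part of the requirement. -/
structure IsRepresentingMeasure (K : Set (ι → ℝ)) (σ : SignedMeasure (ι → ℝ))
    (Λ : MvPolynomial ι ℝ →ₗ[ℝ] ℝ) : Prop where
  variation_compl : σ.variation Kᶜ = 0
  integrable (p : MvPolynomial ι ℝ) : σ.Integrable fun x => eval x p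
  integral_eq (p : MvPolynomial ι ℝ) : ∫ᵛ x, eval x p ∂<•σ = Λ p

namespace IsRepresentingMeasure

lemma sub (hσ : IsRepresentingMeasure K σ Λ) (hτ : IsRepresentingMeasure K τ Λ') :
    IsRepresentingMeasure K (σ - τ) (Λ - Λ') where
  variation_compl := by
    have := VectorMeasure.variation_sub_le (μ := σ) (ν := τ) Kᶜ
    rwa [Measure.add_apply, hσ.variation_compl, hτ.variation_compl, add_zero,
      nonpos_iff_eq_zero] at this
  integrable p := (hσ.integrable p).sub_vectorMeasure (hτ.integrable p)
  integral_eq p := by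
    rw [VectorMeasure.integral_sub_vectorMeasure (hσ.integrable p) (hτ.integrable p),
      hσ.integral_eq, hτ.integral_eq, LinearMap.sub_apply]

lemma smul (hσ : IsRepresentingMeasure K σ Λ) (c : ℝ) :
    IsRepresentingMeasure K (c • σ) (c • Λ) where
  variation_compl := by
    simp [VectorMeasure.variation_smul, hσ.variation_compl]
  integrable p := (hσ.integrable p).smul_vectorMeasure c
  integral_eq p := by
    rw [VectorMeasure.integral_smul_vectorMeasure, hσ.integral_eq, LinearMap.smul_apply]

lemma sum {κ : Type*} {s : Finset κ} {σ : κ → SignedMeasure (ι → ℝ)}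
    {Λ : κ → MvPolynomial ι ℝ →ₗ[ℝ] ℝ} (h : ∀ k ∈ s, IsRepresentingMeasure K (σ k) (Λ k)) :
    IsRepresentingMeasure K (∑ k ∈ s, σ k) (∑ k ∈ s, Λ k) where
  variation_compl := by
    have := VectorMeasure.variation_finsetSum_le s σ Kᶜ
    rwa [Measure.finsetSum_apply, Finset.sum_eq_zero fun k hk => (h k hk).variation_compl,
      nonpos_iff_eq_zero] at this
  integrable p := VectorMeasure.Integrable.finsetSum_vectorMeasure fun k hk => (h k hk).integrable p
  integral_eq p := by
    rw [VectorMeasure.integral_finsetSum_vectorMeasure fun k hk => (h k hk).integrable p,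
      LinearMap.sum_apply, Finset.sum_congr rfl fun k hk => (h k hk).integral_eq p]

end IsRepresentingMeasure

lemma exists_toSignedMeasure_eq {X : Type*} [MeasurableSpace X] {s : SignedMeasure X}
    (hs : 0 ≤ s) : ∃ (μ : Measure X) (_ : IsFiniteMeasure μ), μ.toSignedMeasure = s := by
  have hle : 0 ≤[Set.univ] s := by
    rwa [VectorMeasure.restrict_univ, VectorMeasure.restrict_univ]
  exact ⟨_, inferInstance, s.toMeasureOfZeroLE_toSignedMeasure hle⟩

lemma isRepresentingMeasure_toSignedMeasure_iff {μ : Measure (ι → ℝ)} [IsFiniteMeasure μ] :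
    IsRepresentingMeasure K μ.toSignedMeasure Λ ↔ μ Kᶜ = 0 ∧
      (∀ p, Integrable (fun x => eval x p) μ) ∧ ∀ p, ∫ x, eval x p ∂μ = Λ p := by
  have hint : ∀ p : MvPolynomial ι ℝ, μ.toSignedMeasure.Integrable (fun x => eval x p) ↔
      Integrable (fun x => eval x p) μ := fun p => by
    rw [VectorMeasure.Integrable, Measure.variation_toSignedMeasure]
  constructor
  · rintro ⟨hK, hint', heq⟩
    rw [Measure.variation_toSignedMeasure] at hK
    exact ⟨hK, fun p => (hint p).1 (hint' p), fun p =>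
      VectorMeasure.integral_toSignedMeasure.symm.trans (heq p)⟩
  · rintro ⟨hK, hint', heq⟩
    exact ⟨by rwa [Measure.variation_toSignedMeasure], fun p => (hint p).2 (hint' p), fun p =>
      VectorMeasure.integral_toSignedMeasure.trans (heq p)⟩

lemma IsRepresentingMeasure.nonneg (h : IsRepresentingMeasure K σ Λ) (hσ : 0 ≤ σ)
    {p : MvPolynomial ι ℝ} (hp : ∀ x ∈ K, 0 ≤ eval x p) : 0 ≤ Λ p := by
  obtain ⟨μ, _, rfl⟩ := exists_toSignedMeasure_eq hσ
  obtain ⟨hμK, -, hμ⟩ := isRepresentingMeasure_toSignedMeasure_iff.1 h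
  rw [← hμ]
  refine integral_nonneg_of_ae ?_
  filter_upwards [show ∀ᵐ x ∂μ, x ∈ K from hμK] with x hx using hp x hx

variable [Countable ι]

lemma integrable_eval_of_isCompact (hK : IsCompact K) {μ : Measure (ι → ℝ)} [IsFiniteMeasure μ]
    (hμ : μ Kᶜ = 0) (p : MvPolynomial ι ℝ) : Integrable (fun x => eval x p) μ := by
  rw [← Measure.restrict_eq_self_of_ae_mem (show ∀ᵐ x ∂μ, x ∈ K from hμ)]
  exact (continuous_eval p).continuousOn.integrableOn_compact hK

lemma exists_isRepresentingMeasure_of_nonneg (hK : IsCompact K)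
    (hΛ : ∀ p, (∀ x ∈ K, 0 ≤ eval x p) → 0 ≤ Λ p) :
    ∃ σ, 0 ≤ σ ∧ IsRepresentingMeasure K σ Λ := by
  obtain ⟨μ, _, hμK, hμ⟩ := exists_measure_of_nonneg hK hΛ
  exact ⟨μ.toSignedMeasure, Measure.zero_le_toSignedMeasure μ,
    isRepresentingMeasure_toSignedMeasure_iff.2 ⟨hμK, integrable_eval_of_isCompact hK hμK, hμ⟩⟩

lemma IsRepresentingMeasure.eq_zero (hK : IsCompact K) (h : IsRepresentingMeasure K σ 0) :
    σ = 0 := by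
  have hdec := σ.toSignedMeasure_toJordanDecomposition
  rw [JordanDecomposition.toSignedMeasure] at hdec
  have hvar := h.variation_compl
  rw [← SignedMeasure.totalVariation_eq_variation, SignedMeasure.totalVariation,
    Measure.add_apply, add_eq_zero] at hvar
  have heq := measure_eq_of_integral_eval_eq hK hvar.1 hvar.2 fun p => by
    have hp := h.integral_eq p
    rw [← hdec, VectorMeasure.integral_sub_vectorMeasure
      (by simpa [VectorMeasure.Integrable] using integrable_eval_of_isCompact hK hvar.1 p)
      (by simpa [VectorMeasure.Integrable] using integrable_eval_of_isCompact hK hvar.2 p),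
      VectorMeasure.integral_toSignedMeasure, VectorMeasure.integral_toSignedMeasure] at hp
    exact sub_eq_zero.1 hp
  rw [← hdec, sub_eq_zero]
  simp only [heq]

lemma IsRepresentingMeasure.unique (hK : IsCompact K) (hσ : IsRepresentingMeasure K σ Λ)
    (hτ : IsRepresentingMeasure K τ Λ) : σ = τ :=
  sub_eq_zero.1 (eq_zero hK (sub_self Λ ▸ hσ.sub hτ))

lemma IsRepresentingMeasure.measure_nonneg (hK : IsCompact K) (hσ : IsRepresentingMeasure K σ Λ)
    (hΛ : ∀ p, (∀ x ∈ K, 0 ≤ eval x p) → 0 ≤ Λ p) : 0 ≤ σ := by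
  obtain ⟨τ, hτ, hτΛ⟩ := exists_isRepresentingMeasure_of_nonneg hK hΛ
  rwa [hσ.unique hK hτΛ]

end RepresentingMeasure

section PositiveSemidefinite

variable {t : ℕ} {m : Type*} [Fintype m]

/-- A real square matrix with nonnegative quadratic form. As for `IsPositiveDefinite`, the matrix
is not required to be symmetric. -/
def IsPositiveSemidefinite (G : Matrix m m ℝ) : Prop :=
  ∀ v : m → ℝ, 0 ≤ v ⬝ᵥ G *ᵥ v

lemma IsPositiveDefinite.isPositiveSemidefinite {G : Matrix (Fin t) (Fin t) ℝ}
    (hG : IsPositiveDefinite G) : IsPositiveSemidefinite G := fun v => by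
  rcases eq_or_ne v 0 with rfl | hv
  · rw [zero_dotProduct]
  · exact (hG v hv).le

lemma IsPositiveSemidefinite.add_smul_one {G : Matrix (Fin t) (Fin t) ℝ}
    (hG : IsPositiveSemidefinite G) {ε : ℝ} (hε : 0 < ε) : IsPositiveDefinite (G + ε • 1) := by
  intro v hv
  rw [Matrix.add_mulVec, Matrix.smul_mulVec, Matrix.one_mulVec, dotProduct_add, dotProduct_smul]
  exact add_pos_of_nonneg_of_pos (hG v) (smul_pos hε (Matrix.dotProduct_star_self_pos_iff.2 hv))

lemma nonneg_of_nonneg_isPositiveDefinite {f : Matrix (Fin t) (Fin t) ℝ →ₗ[ℝ] ℝ}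
    (hf : ∀ G, IsPositiveDefinite G → 0 ≤ f G) {G : Matrix (Fin t) (Fin t) ℝ}
    (hG : IsPositiveSemidefinite G) : 0 ≤ f G := by
  have hlim : Tendsto (fun ε : ℝ => f (G + ε • 1)) (𝓝[>] 0) (𝓝 (f G)) := by
    have : Continuous fun ε : ℝ => f G + ε * f 1 := by fun_prop
    simpa using! (this.tendsto 0).mono_left nhdsWithin_le_nhds
  refine ge_of_tendsto hlim ?_
  filter_upwards [self_mem_nhdsWithin] with ε hε using hf _ (hG.add_smul_one hε)

lemma IsPositiveSemidefinite.sum_mul_nonneg {G P : Matrix m m ℝ} (hG : IsPositiveSemidefinite G)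
    (hP : P.PosSemidef) : 0 ≤ ∑ i, ∑ j, G i j * P j i := by
  obtain ⟨r, w, rfl⟩ := Matrix.posSemidef_iff_eq_sum_vecMulVec.1 hP
  have : ∑ i, ∑ j, G i j * (∑ k, Matrix.vecMulVec (w k) (star (w k))) j i
      = ∑ k, w k ⬝ᵥ G *ᵥ w k := by
    simp only [Matrix.sum_apply, Matrix.vecMulVec_apply, star_trivial, dotProduct,
      Matrix.mulVec, Finset.mul_sum]
    rw [Finset.sum_comm (s := Finset.univ (α := Fin r))]
    refine Finset.sum_congr rfl fun i _ => ?_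
    rw [Finset.sum_comm]
    exact Finset.sum_congr rfl fun k _ => Finset.sum_congr rfl fun j _ => by ring
  rw [this]
  exact Finset.sum_nonneg fun k _ => hG _

lemma isPositiveSemidefinite_vecMulVec_self (v : m → ℝ) :
    IsPositiveSemidefinite (Matrix.vecMulVec v v) := by
  intro w
  simpa using! (Matrix.posSemidef_vecMulVec_self_star v).dotProduct_mulVec_nonneg w

variable [DecidableEq m]

lemma dotProduct_single_mulVec (i j : m) (v : m → ℝ) :
    v ⬝ᵥ Matrix.single i j 1 *ᵥ v = v i * v j := by
  simp [Matrix.single_mulVec_eq, mul_comm]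

lemma isPositiveSemidefinite_single_add_single (i j : m) :
    IsPositiveSemidefinite (Matrix.single i i 1 + Matrix.single j j 1) := fun v => by
  rw [Matrix.add_mulVec, dotProduct_add, dotProduct_single_mulVec, dotProduct_single_mulVec]
  nlinarith

lemma isPositiveSemidefinite_single_add (i j : m) :
    IsPositiveSemidefinite
      (Matrix.single i j 1 + (Matrix.single i i 1 + Matrix.single j j 1)) := fun v => by
  rw [Matrix.add_mulVec, Matrix.add_mulVec, dotProduct_add, dotProduct_add,
    dotProduct_single_mulVec, dotProduct_single_mulVec, dotProduct_single_mulVec]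
  nlinarith [sq_nonneg (v i + v j)]

lemma isPositiveSemidefinite_single_sub_single (i j : m) :
    IsPositiveSemidefinite (Matrix.single i j 1 - Matrix.single j i 1) := fun v => by
  rw [Matrix.sub_mulVec, dotProduct_sub, dotProduct_single_mulVec, dotProduct_single_mulVec,
    mul_comm, sub_self]

end PositiveSemidefinite

section TracialFunctional

variable {n t : ℕ} {K : Set (Fin n → ℝ)}
  {L : Matrix (Fin t) (Fin t) (MvPolynomial (Fin n) ℝ) →ₗ[ℝ] ℝ}

/-- The functional `L`, restricted to matrices of the form `p G` with `p` a polynomial and `G` a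
scalar matrix, as a bilinear map in `G` and `p`. -/
noncomputable def slice (L : Matrix (Fin t) (Fin t) (MvPolynomial (Fin n) ℝ) →ₗ[ℝ] ℝ) :
    Matrix (Fin t) (Fin t) ℝ →ₗ[ℝ] MvPolynomial (Fin n) ℝ →ₗ[ℝ] ℝ :=
  LinearMap.mk₂ ℝ (fun G p => L (p • constMatrix n G))
    (fun G H p => by
      rw [← map_add, ← smul_add, constMatrix, Matrix.map_add _ (map_add C)]; rfl)
    (fun c G p => by
      rw [← map_smul, smul_comm]
      congr 2
      ext1 i j
      simp [constMatrix, smul_eq_C_mul])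
    (fun G p q => by rw [add_smul, map_add])
    (fun c G p => by rw [smul_assoc, map_smul])

lemma slice_apply (G : Matrix (Fin t) (Fin t) ℝ) (p : MvPolynomial (Fin n) ℝ) :
    slice L G p = L (p • constMatrix n G) := rfl

lemma eq_sum_slice_single (F : Matrix (Fin t) (Fin t) (MvPolynomial (Fin n) ℝ)) :
    L F = ∑ i, ∑ j, slice L (Matrix.single i j 1) (F i j) := by
  conv_lhs => rw [Matrix.matrix_eq_sum_single F]
  simp only [map_sum, slice_apply]
  refine Finset.sum_congr rfl fun i _ => Finset.sum_congr rfl fun j _ => ?_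
  simp [constMatrix, Matrix.smul_single]

lemma slice_eq_sum_smul (G : Matrix (Fin t) (Fin t) ℝ) :
    slice L G = ∑ i, ∑ j, G i j • slice L (Matrix.single i j 1) := by
  conv_lhs => rw [Matrix.matrix_eq_sum_single G]
  simp only [map_sum]
  refine Finset.sum_congr rfl fun i _ => Finset.sum_congr rfl fun j _ => ?_
  rw [← map_smul, Matrix.smul_single, smul_eq_mul, mul_one]

lemma isRepresentingMeasure_slice {E : MatrixMeasure n t}
    (hE : ∀ i j, IsRepresentingMeasure K (E j i) (slice L (Matrix.single i j 1)))
    (G : Matrix (Fin t) (Fin t) ℝ) :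
    IsRepresentingMeasure K (∑ i, ∑ j, G i j • E j i) (slice L G) := by
  rw [slice_eq_sum_smul]
  exact .sum fun i _ => .sum fun j _ => (hE i j).smul _

lemma isTracialMomentFunctional_iff_exists_isRepresentingMeasure (hK : IsClosed K) :
    IsTracialMomentFunctional K L ↔ ∃ E : MatrixMeasure n t, E.IsPosSemidef ∧
      ∀ i j, IsRepresentingMeasure K (E j i) (slice L (Matrix.single i j 1)) := by
  constructor
  · rintro ⟨E, hE, hsupp, hrep⟩
    refine ⟨E, hE, fun i j => ⟨?_, fun p => (hrep (Matrix.of fun _ _ => p)).1 i j, fun p => ?_⟩⟩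
    · refine measure_mono_null (Set.compl_subset_compl.2 ?_) Measure.measure_compl_support
      exact (Set.subset_iUnion₂ (s := fun a b => (E a b).variation.support) j i).trans hsupp
    · rw [slice_apply, (hrep _).2, MatrixMeasure.traceIntegral,
        Finset.sum_eq_single i, Finset.sum_eq_single j]
      · simp [constMatrix]
      · intro b _ hb
        simp [constMatrix, Matrix.single_apply_of_col_ne _ _ hb.symm]
      · simp
      · intro a _ ha
        simp [constMatrix, Matrix.single_apply_of_row_ne ha.symm]
      · simp
  · rintro ⟨E, hE, hrep⟩
    refine ⟨E, hE, Set.iUnion₂_subset fun a b =>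
      Measure.support_subset_of_isClosed hK (hrep b a).variation_compl, fun F =>
      ⟨fun i j => (hrep i j).integrable _, ?_⟩⟩
    rw [eq_sum_slice_single, MatrixMeasure.traceIntegral]
    simp only [(hrep _ _).integral_eq]

lemma MatrixMeasure.IsPosSemidef.sum_smul_nonneg {E : MatrixMeasure n t} (hE : E.IsPosSemidef)
    {G : Matrix (Fin t) (Fin t) ℝ} (hG : IsPositiveSemidefinite G) :
    0 ≤ ∑ i, ∑ j, G i j • E j i := by
  refine VectorMeasure.le_iff.2 fun A hA => ?_
  have hEA : (E.value A).PosSemidef := .of_dotProduct_mulVec_nonneg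
    (by ext i j; simp [MatrixMeasure.value, hE.1 i j]) (by simpa using hE.2 A hA)
  simpa [MatrixMeasure.value] using hG.sum_mul_nonneg hEA

lemma MatrixMeasure.sum_single_smul (E : MatrixMeasure n t) (i j : Fin t) :
    ∑ a, ∑ b, Matrix.single i j (1 : ℝ) a b • E b a = E j i := by
  simp [Matrix.single_apply, ite_and]

lemma MatrixMeasure.dotProduct_value_mulVec (E : MatrixMeasure n t) (A : Set (Fin n → ℝ))
    (v : Fin t → ℝ) :
    v ⬝ᵥ E.value A *ᵥ v = (∑ i, ∑ j, Matrix.vecMulVec v v i j • E j i) A := by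
  simp only [dotProduct, Matrix.mulVec, value, Matrix.of_apply, Finset.mul_sum,
    sum_apply, smul_apply, Matrix.vecMulVec_apply, smul_eq_mul]
  rw [Finset.sum_comm]
  exact Finset.sum_congr rfl fun i _ => Finset.sum_congr rfl fun j _ => by ring

lemma MatrixMeasure.isPosSemidef_of_sum_smul_nonneg {E : MatrixMeasure n t}
    (hE : ∀ G : Matrix (Fin t) (Fin t) ℝ, IsPositiveSemidefinite G →
      0 ≤ ∑ i, ∑ j, G i j • E j i) : E.IsPosSemidef := by
  have hsymm : ∀ i j, E i j ≤ E j i := fun i j => by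
    have hsub : ∑ a, ∑ b,
        (Matrix.single i j 1 - Matrix.single j i 1 : Matrix (Fin t) (Fin t) ℝ) a b • E b a
        = E j i - E i j := by
      rw [← E.sum_single_smul i j, ← E.sum_single_smul j i]
      simp only [← Finset.sum_sub_distrib]
      exact Finset.sum_congr rfl fun a _ => Finset.sum_congr rfl fun b _ =>
        sub_smul (Matrix.single i j (1 : ℝ) a b) (Matrix.single j i 1 a b) (E b a)
    exact sub_nonneg.1 (hsub ▸ hE _ (isPositiveSemidefinite_single_sub_single i j))
  refine ⟨fun i j => (hsymm i j).antisymm (hsymm j i), fun A hA v => ?_⟩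
  rw [dotProduct_value_mulVec]
  exact VectorMeasure.le_iff.1 (hE _ (isPositiveSemidefinite_vecMulVec_self v)) A hA

lemma exists_isRepresentingMeasure_slice_single (hK : IsCompact K)
    (hL : ∀ G, IsPositiveSemidefinite G → ∀ p, (∀ x ∈ K, 0 ≤ eval x p) → 0 ≤ slice L G p)
    (i j : Fin t) : ∃ σ, IsRepresentingMeasure K σ (slice L (Matrix.single i j 1)) := by
  obtain ⟨σ, -, hσ⟩ := exists_isRepresentingMeasure_of_nonneg hK
    (hL _ (isPositiveSemidefinite_single_add i j))
  obtain ⟨τ, -, hτ⟩ := exists_isRepresentingMeasure_of_nonneg hK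
    (hL _ (isPositiveSemidefinite_single_add_single i j))
  refine ⟨σ - τ, ?_⟩
  rw [← add_sub_cancel_right (Matrix.single i j 1) (Matrix.single i i 1 + Matrix.single j j 1),
    map_sub]
  exact hσ.sub hτ

theorem isTracialMomentFunctional_iff_slice_nonneg (hK : IsCompact K) :
    IsTracialMomentFunctional K L ↔
      ∀ G, IsPositiveSemidefinite G → ∀ p, (∀ x ∈ K, 0 ≤ eval x p) → 0 ≤ slice L G p := by
  rw [isTracialMomentFunctional_iff_exists_isRepresentingMeasure hK.isClosed]
  constructor
  · rintro ⟨E, hE, hrep⟩ G hG p hp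
    exact (isRepresentingMeasure_slice hrep G).nonneg (hE.sum_smul_nonneg hG) hp
  · intro hL
    choose σ hσ using exists_isRepresentingMeasure_slice_single hK hL
    refine ⟨fun i j => σ j i, MatrixMeasure.isPosSemidef_of_sum_smul_nonneg fun G hG => ?_, hσ⟩
    exact (isRepresentingMeasure_slice hσ G).measure_nonneg hK (hL G hG)

end TracialFunctional

section Hypercube

variable {n : ℕ}

lemma boxPoly_two_mul (i : Fin n) : boxPoly n ⟨2 * i, by omega⟩ = 1 + X i := by
  simp [boxPoly]

lemma boxPoly_two_mul_add_one (i : Fin n) : boxPoly n ⟨2 * i + 1, by omega⟩ = 1 - X i := by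
  simp [boxPoly, Nat.add_mod, Nat.mul_add_div]

lemma nonnegSet_boxPoly (n : ℕ) : nonnegSet (boxPoly n) = hypercube n := by
  ext x
  constructor
  · intro hx i
    have hlower := hx ⟨2 * i, by omega⟩
    have hupper := hx ⟨2 * i + 1, by omega⟩
    rw [boxPoly_two_mul, map_add, map_one, eval_X] at hlower
    rw [boxPoly_two_mul_add_one, map_sub, map_one, eval_X] at hupper
    exact ⟨by linarith, by linarith⟩
  · intro hx j
    obtain ⟨hlower, hupper⟩ := hx ⟨j / 2, by omega⟩
    unfold boxPoly
    split_ifs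
    · rw [map_add, map_one, eval_X]; linarith
    · rw [map_sub, map_one, eval_X]; linarith

lemma isArchimedean_adjoin_boxPoly (n : ℕ) :
    IsArchimedean (Algebra.adjoin ℝ≥0 (Set.range (boxPoly n))) := by
  refine isArchimedean_of_boundedElements_eq_top (top_unique ?_)
  rw [← adjoin_range_X, Algebra.adjoin_le_iff]
  rintro _ ⟨i, rfl⟩
  refine ⟨1, ?_, ?_⟩
  · rw [map_one, ← boxPoly_two_mul_add_one]
    exact Algebra.subset_adjoin ⟨_, rfl⟩
  · rw [map_one, ← boxPoly_two_mul]
    exact Algebra.subset_adjoin ⟨_, rfl⟩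

end Hypercube

end TracialMoment

open scoped NNReal in
theorem mainTheorem1_general {n t : ℕ} {κ : Type*} [Fintype κ]
    {g : κ → MvPolynomial (Fin n) ℝ}
    (hg : TracialMoment.IsArchimedean (Algebra.adjoin ℝ≥0 (Set.range g)))
    (L : Matrix (Fin t) (Fin t) (MvPolynomial (Fin n) ℝ) →ₗ[ℝ] ℝ) :
    TracialMoment.IsTracialMomentFunctional (TracialMoment.nonnegSet g) L ↔
      ∀ G : Matrix (Fin t) (Fin t) ℝ, TracialMoment.IsPositiveDefinite G →
        ∀ α : κ → ℕ, 0 ≤ L ((∏ j, g j ^ α j) • TracialMoment.constMatrix n G) := by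
  rw [TracialMoment.isTracialMomentFunctional_iff_slice_nonneg
    (TracialMoment.isCompact_nonnegSet hg)]
  constructor
  · intro hL G hG α
    refine hL G hG.isPositiveSemidefinite _ fun x hx => ?_
    simp only [map_prod, map_pow]
    exact Finset.prod_nonneg fun j _ => pow_nonneg (hx j) _
  · intro hL G hG p hp
    refine TracialMoment.nonneg_of_nonneg_isPositiveDefinite
      (f := (TracialMoment.slice L).flip p) (fun H hH => ?_) hG
    exact TracialMoment.nonneg_of_nonneg_on_nonnegSet hg (Λ := TracialMoment.slice L H) (hL H hH) hp

theorem mainTheorem1 (n t : ℕ)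
    (L : Matrix (Fin t) (Fin t) (MvPolynomial (Fin n) ℝ) →ₗ[ℝ] ℝ) :
    TracialMoment.IsTracialMomentFunctional (TracialMoment.hypercube n) L ↔
      ∀ G : Matrix (Fin t) (Fin t) ℝ, TracialMoment.IsPositiveDefinite G →
        ∀ α : Fin (2 * n) → ℕ,
          0 ≤ L ((∏ j, TracialMoment.boxPoly n j ^ α j) • TracialMoment.constMatrix n G) := by
  rw [← TracialMoment.nonnegSet_boxPoly]
  exact mainTheorem1_general (TracialMoment.isArchimedean_adjoin_boxPoly n) L
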